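/- Let $T>0$, $B\in\mathbb{R}^{n\times m}$, $C\in\mathbb{R}^{r\times n}$, $x_0\in\mathbb{R}^n$ and $y\in L^2(0,T;\mathbb{R}^r)$ be given. An uncertain system consists of finite parameter sets $\Sigma_A\subset\mathbb{R}^{s_A}$, $\Sigma_\Gamma\subset\mathbb{R}^{s_\Gamma}$, $\Sigma_R\subset\mathbb{R}^{s_R}$, $\Sigma_Q\subset\mathbb{R}^{s_Q}$ and matrix-valued functions of the respective parameters; for $\sigma=(\sigma_A,\sigma_\Gamma,\sigma_R,\sigma_Q)\in\Sigma=\Sigma_A\times\Sigma_\Gamma\times\Sigma_R\times\Sigma_Q$ they give a matrix $A_\sigma\in\mathbb{R}^{n\times n}$ (depending on $\sigma_A$) and symmetric positive definite matrices $\Gamma_\sigma\in\mathbb{R}^{n\times n}$, $R_\sigma\in\mathbb{R}^{m\times m}$, $Q_\sigma\in\mathbb{R}^{r\times r}$ (depending on $\sigma_\Gamma,\sigma_R,\sigma_Q$, respectively). Put $N=|\Sigma|$, let $\mathbb{E}[f_\sigma]=\frac1N\sum_{\sigma\in\Sigma}f_\sigma$, write $\mathcal{S}_\sigma=(A_\sigma,\Gamma_\sigma,R_\sigma,Q_\sigma)$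 and, with the spectral norm of matrices, $$\|\mathcal{S}_\sigma-\mathcal{S}_{\bar\sigma}\|_1=\|A_\sigma-A_{\bar\sigma}\|+\|\Gamma_\sigma-\Gamma_{\bar\sigma}\|+\|R_\sigma-R_{\bar\sigma}\|+\|Q_\sigma-Q_{\bar\sigma}\|.$$ For $\sigma\in\Sigma$ let $\Pi_\sigma$ and $\widehat{x}_\sigma\in H^1(0,T;\mathbb{R}^n)$ be the solutions on $[0,T]$ of $$\dot\Pi_\sigma=A_\sigma\Pi_\sigma+\Pi_\sigma A_\sigma^\top-\Pi_\sigma C^\top Q_\sigma^{-1}C\Pi_\sigma+BR_\sigma B^\top,\quad \Pi_\sigma(0)=\Gamma_\sigma,$$ $$\dot{\widehat{x}}_\sigma=A_\sigma\widehat{x}_\sigma+\Pi_\sigma C^\top Q_\sigma^{-1}(y-C\widehat{x}_\sigma),\quad \widehat{x}_\sigma(0)=x_0,$$ and put $P_\sigma(t)=\Pi_\sigma(t)^{-1}$, $\widehat{x}_\varnothing=\mathbb{E}[\widehat{x}_\sigma]=\frac1N\sum_{\sigma\in\Sigma}\widehat{x}_\sigma$ and $\|v\|_P=\sqrt{v^\top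 Pv}$. Then for every $M$ there is a constant $c_\varnothing>0$, depending only on $T,B,C,x_0,y$ and $M$ (in particular not on $N$), such that for every uncertain system for which $A_\sigma,\Gamma_\sigma,R_\sigma,Q_\sigma,\Gamma_\sigma^{-1},Q_\sigma^{-1}$ all have norm at most $M$ for all $\sigma\in\Sigma$, for every $\bar\sigma\in\Sigma$ and for all $t\in[0,T]$, $$\|\widehat{x}_\varnothing(t)-\widehat{x}_{\bar\sigma}(t)\|_{P_{\bar\sigma}(t)}\le c_\varnothing\,\mathbb{E}\big[\|\mathcal{S}_\sigma-\mathcal{S}_{\bar\sigma}\|_1\big].$$ -/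

import Mathlib

open MeasureTheory Set
open scoped Matrix Matrix.Norms.L2Operator

noncomputable section

namespace UncertainKalman

/-- The four-tuple `(A, Γ, R, Q)` of system matrix and covariance matrices. -/
@[ext]
structure Sys (n m r : ℕ) where
  A : Matrix (Fin n) (Fin n) ℝ
  Γ : Matrix (Fin n) (Fin n) ℝ
  R : Matrix (Fin m) (Fin m) ℝ
  Q : Matrix (Fin r) (Fin r) ℝ

/-- Differences of four-tuples are taken componentwise. -/
instance (n m r : ℕ) : Sub (Sys n m r) where
  sub S S' := ⟨S.A - S'.A, S.Γ - S'.Γ, S.R - S'.R, S.Q - S'.Q⟩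

/-- `‖S‖₁ = ‖A‖ + ‖Γ‖ + ‖R‖ + ‖Q‖`, with spectral norms of the matrices. -/
def Sys.norm1 {n m r : ℕ} (S : Sys n m r) : ℝ :=
  ‖S.A‖ + ‖S.Γ‖ + ‖S.R‖ + ‖S.Q‖

/-- The weighted norm `‖x‖_P = √(xᵀ P x)`. -/
def weightedNorm {n : ℕ} (P : Matrix (Fin n) (Fin n) ℝ) (x : EuclideanSpace ℝ (Fin n)) : ℝ :=
  Real.sqrt (x.ofLp ⬝ᵥ (P *ᵥ x.ofLp))

/-- `Π` is a (classical) solution on `[0,T]` of the differential Riccati equation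
`Π' = A Π + Π Aᵀ - Π Cᵀ Q⁻¹ C Π + B R Bᵀ` on `(0,T)`, `Π(0) = Γ`. -/
structure IsRiccatiSolution {n m r : ℕ} (T : ℝ) (B : Matrix (Fin n) (Fin m) ℝ)
    (C : Matrix (Fin r) (Fin n) ℝ) (S : Sys n m r)
    (Pi : ℝ → Matrix (Fin n) (Fin n) ℝ) : Prop where
  continuousOn : ContinuousOn Pi (Icc 0 T)
  hasDerivAt : ∀ t ∈ Ioo 0 T,
    HasDerivAt Pi
      (S.A * Pi t + Pi t * S.Aᵀ - Pi t * Cᵀ * S.Q⁻¹ * C * Pi t + B * S.R * Bᵀ) t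
  initial : Pi 0 = S.Γ

/-- `x` is the `H¹(0,T)`-solution of the Kalman filter equation
`x' = A x + Π Cᵀ Q⁻¹ (y - C x)` on `(0,T)`, `x(0) = x₀`. As `y` is only square integrable, the
equation holds almost everywhere, that is, in integrated form for the continuous
representative `x`. -/
structure IsKalmanSolution {n m r : ℕ} (T : ℝ)
    (C : Matrix (Fin r) (Fin n) ℝ) (x₀ : EuclideanSpace ℝ (Fin n))
    (y : ℝ → EuclideanSpace ℝ (Fin r)) (S : Sys n m r)
    (Pi : ℝ → Matrix (Fin n) (Fin n) ℝ) (x : ℝ → EuclideanSpace ℝ (Fin n)) : Prop where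
  continuousOn : ContinuousOn x (Icc 0 T)
  integral_eq : ∀ t ∈ Icc 0 T,
    x t = x₀ + ∫ s in (0 : ℝ)..t,
      (Matrix.toEuclideanLin S.A (x s)
        + Matrix.toEuclideanLin (Pi s * Cᵀ * S.Q⁻¹) (y s - Matrix.toEuclideanLin C (x s)))

/-- The model of the uncertain matrices: each of the four matrices is a matrix-valued function on
its own parameter space, and each parameter is uniformly distributed on a finite set. The
covariance matrices are symmetric positive definite for all possible parameters. -/
structure UncertainModel (n m r : ℕ) where
  sA : ℕ
  sΓ : ℕ
  sR : ℕ
  sQ : ℕ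
  a : EuclideanSpace ℝ (Fin sA) → Matrix (Fin n) (Fin n) ℝ
  γ : EuclideanSpace ℝ (Fin sΓ) → Matrix (Fin n) (Fin n) ℝ
  ρ : EuclideanSpace ℝ (Fin sR) → Matrix (Fin m) (Fin m) ℝ
  q : EuclideanSpace ℝ (Fin sQ) → Matrix (Fin r) (Fin r) ℝ
  setA : Finset (EuclideanSpace ℝ (Fin sA))
  setΓ : Finset (EuclideanSpace ℝ (Fin sΓ))
  setR : Finset (EuclideanSpace ℝ (Fin sR))
  setQ : Finset (EuclideanSpace ℝ (Fin sQ))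
  γ_posDef : ∀ σ ∈ setΓ, (γ σ).PosDef
  ρ_posDef : ∀ σ ∈ setR, (ρ σ).PosDef
  q_posDef : ∀ σ ∈ setQ, (q σ).PosDef

namespace UncertainModel

variable {n m r : ℕ} (𝓜 : UncertainModel n m r)

/-- The full parameter `σ = (σ_A, σ_Γ, σ_R, σ_Q)`. -/
abbrev Param : Type :=
  EuclideanSpace ℝ (Fin 𝓜.sA) × EuclideanSpace ℝ (Fin 𝓜.sΓ) ×
    EuclideanSpace ℝ (Fin 𝓜.sR) × EuclideanSpace ℝ (Fin 𝓜.sQ)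

/-- `Σ = Σ_A × Σ_Γ × Σ_R × Σ_Q`. -/
def paramSet : Finset 𝓜.Param :=
  𝓜.setA ×ˢ 𝓜.setΓ ×ˢ 𝓜.setR ×ˢ 𝓜.setQ

/-- `S_σ = (A_σ, Γ_σ, R_σ, Q_σ)`. -/
def sys (σ : 𝓜.Param) : Sys n m r :=
  ⟨𝓜.a σ.1, 𝓜.γ σ.2.1, 𝓜.ρ σ.2.2.1, 𝓜.q σ.2.2.2⟩

/-- The cardinality `N` of `Σ`. -/
def N : ℕ := 𝓜.paramSet.card

/-- The expectation `(1/N) ∑_{σ ∈ Σ} f(σ)` under the uniform distribution on `Σ`. -/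
def expectation {E : Type*} [AddCommMonoid E] [Module ℝ E] (f : 𝓜.Param → E) : E :=
  (1 / (𝓜.N : ℝ)) • ∑ σ ∈ 𝓜.paramSet, f σ

/-- All matrices `A_σ, Γ_σ, R_σ, Q_σ, Γ_σ⁻¹, Q_σ⁻¹`, `σ ∈ Σ`, have norm at most `M`. Every model
has such a bound, since `Σ` is finite. -/
def BoundedBy (M : ℝ) : Prop :=
  ∀ σ ∈ 𝓜.paramSet,
    ‖(𝓜.sys σ).A‖ ≤ M ∧ ‖(𝓜.sys σ).Γ‖ ≤ M ∧ ‖(𝓜.sys σ).R‖ ≤ M ∧ ‖(𝓜.sys σ).Q‖ ≤ M ∧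
      ‖(𝓜.sys σ).Γ⁻¹‖ ≤ M ∧ ‖(𝓜.sys σ).Q⁻¹‖ ≤ M

end UncertainModel

end UncertainKalman

end

namespace UncertainKalman

/-! The map from `S` to the filter trajectory is Lipschitz in the Euclidean norm, with a constant
uniform over all data bounded by `M`. Averaging this estimate over `σ` costs nothing, since the
distance of a mean to a point is at most the mean distance, and so `N` never enters.

Uniformity rests on two-sided bounds `ε I ≤ Π ≤ p I` (`exists_riccati_bounds`), found by comparing
`Π` with exponentially decaying or growing multiples of the identity. At a first contact the
touching vector is an eigenvector of `Π`, and the Riccati equation then gives the derivative of the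
gap a strict sign (`quadForm_nonneg_of_barrier`). The lower bound replaces the weight `Π⁻¹` by the
factor `√ε⁻¹`. The upper bound makes the quadratic Riccati term Lipschitz, so Grönwall applies to
differences of Riccati solutions (`exists_riccati_lipschitz`), hence to the gains `Π Cᵀ Q⁻¹`, and
finally to differences of trajectories (`exists_kalman_lipschitz`). -/

/-! ### Grönwall estimates -/

/-- Grönwall's inequality in integral form. -/
lemma le_mul_exp_of_le_add_integral {T a L : ℝ} {u : ℝ → ℝ} (hL : 0 ≤ L)
    (hu : ContinuousOn u (Icc 0 T))
    (h : ∀ t ∈ Icc 0 T, u t ≤ a + L * ∫ s in (0 : ℝ)..t, u s) :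
    ∀ t ∈ Icc 0 T, u t ≤ a * Real.exp (L * t) := by
  intro t ht
  -- With the integrating factor, `F' = L e^(-Lt) (u - a - L ∫ u) ≤ 0`, so `F t ≤ F 0 = a`.
  set F : ℝ → ℝ := fun t => Real.exp (-(L * t)) * (a + L * ∫ s in (0 : ℝ)..t, u s) with hF
  have hT : (0 : ℝ) ≤ T := ht.1.trans ht.2
  have hui : IntegrableOn u (uIcc 0 T) := by
    rw [uIcc_of_le hT]; exact hu.integrableOn_Icc
  have hcont : ContinuousOn F (Icc 0 T) := by
    have h1 := intervalIntegral.continuousOn_primitive_interval hui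
    rw [uIcc_of_le hT] at h1
    exact (by fun_prop : Continuous fun t => Real.exp (-(L * t))).continuousOn.mul
      (continuousOn_const.add (continuousOn_const.mul h1))
  have hder : ∀ s ∈ Ioo 0 T, HasDerivAt F
      (Real.exp (-(L * s)) * -L * (a + L * ∫ s in (0 : ℝ)..s, u s)
        + Real.exp (-(L * s)) * (L * u s)) s := by
    intro s hs
    have hmem : Icc 0 T ∈ nhds s := Icc_mem_nhds hs.1 hs.2
    have h1 : HasDerivAt (fun t => ∫ s in (0 : ℝ)..t, u s) (u s) s := by
      refine intervalIntegral.integral_hasDerivAt_right ?_ ?_ (hu.continuousAt hmem)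
      · refine (hu.mono ?_).intervalIntegrable
        rw [uIcc_of_le hs.1.le]
        exact Icc_subset_Icc le_rfl hs.2.le
      · exact (hu.mono Ioo_subset_Icc_self).stronglyMeasurableAtFilter isOpen_Ioo s hs
    have h2 : HasDerivAt (fun t => Real.exp (-(L * t))) (Real.exp (-(L * s)) * -L) s := by
      have := ((hasDerivAt_id s).const_mul L).neg.exp
      simpa using this
    exact h2.mul ((h1.const_mul L).const_add a)
  have hanti : AntitoneOn F (Icc 0 T) := by
    refine antitoneOn_of_deriv_nonpos (convex_Icc 0 T) hcont ?_ ?_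
    · rw [interior_Icc]
      exact fun s hs => (hder s hs).differentiableAt.differentiableWithinAt
    · rw [interior_Icc]
      intro s hs
      rw [(hder s hs).deriv]
      have h1 := h s (Ioo_subset_Icc_self hs)
      have h2 : 0 ≤ Real.exp (-(L * s)) * L := by positivity
      nlinarith [mul_le_mul_of_nonneg_left h1 h2]
  have h0 := hanti (left_mem_Icc.2 hT) ht ht.1
  simp only [hF, mul_zero, neg_zero, Real.exp_zero, one_mul, intervalIntegral.integral_same,
    add_zero] at h0
  refine (h t ht).trans ?_
  have h3 := mul_le_mul_of_nonneg_left h0 (Real.exp_pos (L * t)).le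
  rw [← mul_assoc, ← Real.exp_add, add_neg_cancel, Real.exp_zero, one_mul] at h3
  linarith [mul_comm a (Real.exp (L * t))]

/-- Grönwall's inequality for a curve in a normed space given by an integral equation whose
right-hand side grows at most linearly. -/
lemma norm_le_of_integral_eq {E : Type*} [NormedAddCommGroup E] [NormedSpace ℝ E]
    {T L : ℝ} {f g : ℝ → E} {h : ℝ → ℝ} {f₀ : E} (hL : 0 ≤ L)
    (hf : ContinuousOn f (Icc 0 T)) (heq : ∀ t ∈ Icc 0 T, f t = f₀ + ∫ s in (0 : ℝ)..t, g s)
    (hh : IntervalIntegrable h volume 0 T) (hh0 : ∀ s, 0 ≤ h s)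
    (hg : ∀ s ∈ Ioo 0 T, ‖g s‖ ≤ L * ‖f s‖ + h s) :
    ∀ t ∈ Icc 0 T, ‖f t‖ ≤ (‖f₀‖ + ∫ s in (0 : ℝ)..T, h s) * Real.exp (L * T) := by
  intro t ht
  have hT : (0 : ℝ) ≤ T := ht.1.trans ht.2
  have hH : 0 ≤ ∫ s in (0 : ℝ)..T, h s :=
    intervalIntegral.integral_nonneg hT fun s _ => hh0 s
  refine (le_mul_exp_of_le_add_integral (a := ‖f₀‖ + ∫ s in (0 : ℝ)..T, h s) hL hf.norm
    ?_ t ht).trans ?_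
  · intro s hs
    have hfi : IntervalIntegrable (fun s => ‖f s‖) volume 0 s := by
      refine (hf.norm.mono ?_).intervalIntegrable
      rw [uIcc_of_le hs.1]; exact Icc_subset_Icc le_rfl hs.2
    have hhi : IntervalIntegrable h volume 0 s := hh.mono_set (by
      rw [uIcc_of_le hs.1, uIcc_of_le hT]; exact Icc_subset_Icc le_rfl hs.2)
    have hb : ‖∫ τ in (0 : ℝ)..s, g τ‖ ≤ ∫ τ in (0 : ℝ)..s, (L * ‖f τ‖ + h τ) := by
      refine intervalIntegral.norm_integral_le_of_norm_le hs.1 ?_ ((hfi.const_mul L).add hhi)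
      -- The bound on `g` is known on the open interval only; the endpoint `T` is a null set.
      filter_upwards [Measure.ae_ne volume T] with τ hτ hmem
      exact hg τ ⟨hmem.1, lt_of_le_of_ne (hmem.2.trans hs.2) hτ⟩
    rw [intervalIntegral.integral_add (hfi.const_mul L) hhi,
      intervalIntegral.integral_const_mul] at hb
    have hmono : ∫ τ in (0 : ℝ)..s, h τ ≤ ∫ τ in (0 : ℝ)..T, h τ :=
      intervalIntegral.integral_mono_interval le_rfl hs.1 hs.2
        (Filter.Eventually.of_forall hh0) hh
    rw [heq s hs]
    have := norm_add_le f₀ (∫ τ in (0 : ℝ)..s, g τ)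
    linarith
  · have : L * t ≤ L * T := mul_le_mul_of_nonneg_left ht.2 hL
    gcongr

/-! ### Quadratic forms along matrix curves and the barrier principle -/

variable {n m r : ℕ}

/-- At a first contact this upgrades a zero of the form to a kernel vector, which is what makes the
derivative computable there. -/
lemma mulVec_eq_zero_of_quadForm_eq_zero {A : Matrix (Fin n) (Fin n) ℝ} (hA : Aᵀ = A)
    (hpos : ∀ v : Fin n → ℝ, 0 ≤ v ⬝ᵥ A *ᵥ v) {v : Fin n → ℝ} (hv : v ⬝ᵥ A *ᵥ v = 0) :
    A *ᵥ v = 0 := by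
  have hA' : A.PosSemidef := Matrix.PosSemidef.of_dotProduct_mulVec_nonneg
    (by simpa [Matrix.IsHermitian, Matrix.conjTranspose_eq_transpose_of_trivial] using hA)
    (by simpa using hpos)
  exact (hA'.dotProduct_mulVec_zero_iff v).1 (by simpa using hv)

lemma hasDerivAt_quadForm {G : ℝ → Matrix (Fin n) (Fin n) ℝ} {G' : Matrix (Fin n) (Fin n) ℝ}
    {t : ℝ} (h : HasDerivAt G G' t) (v : Fin n → ℝ) :
    HasDerivAt (fun s => v ⬝ᵥ G s *ᵥ v) (v ⬝ᵥ G' *ᵥ v) t := by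
  let φ : Matrix (Fin n) (Fin n) ℝ →ₗ[ℝ] ℝ :=
    { toFun := fun A => v ⬝ᵥ A *ᵥ v
      map_add' := by intro A B; simp [Matrix.add_mulVec]
      map_smul' := by intro c A; simp [Matrix.smul_mulVec] }
  exact (LinearMap.toContinuousLinearMap φ).hasFDerivAt.comp_hasDerivAt t h

lemma continuousOn_quadForm {s : Set ℝ} {G : ℝ → Matrix (Fin n) (Fin n) ℝ}
    (h : ContinuousOn G s) (v : Fin n → ℝ) : ContinuousOn (fun t => v ⬝ᵥ G t *ᵥ v) s :=
  (by fun_prop : Continuous fun A : Matrix (Fin n) (Fin n) ℝ => v ⬝ᵥ A *ᵥ v).comp_continuousOn h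

lemma quadForm_nonneg_right {G : ℝ → Matrix (Fin n) (Fin n) ℝ} {t : ℝ} (ht : 0 < t)
    (hcont : ContinuousOn G (Icc 0 t)) (h : ∀ s ∈ Ico 0 t, ∀ v, 0 ≤ v ⬝ᵥ G s *ᵥ v)
    (v : Fin n → ℝ) : 0 ≤ v ⬝ᵥ G t *ᵥ v := by
  have hcl : closure (Ico 0 t) = Icc 0 t := closure_Ico ht.ne
  refine le_on_closure (f := fun _ => (0 : ℝ)) (s := Ico 0 t) (fun s hs => h s hs v)
    continuousOn_const ?_ (hcl ▸ right_mem_Icc.2 ht.le)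
  rw [hcl]
  exact continuousOn_quadForm hcont v

/-- A symmetric matrix curve that starts positive definite stays positive semidefinite if, on
the kernel of `G t`, its derivative is positive. -/
lemma quadForm_nonneg_of_barrier {T : ℝ} {G G' : ℝ → Matrix (Fin n) (Fin n) ℝ}
    (hcont : ContinuousOn G (Icc 0 T)) (hder : ∀ t ∈ Ioo 0 T, HasDerivAt G (G' t) t)
    (hsymm : ∀ t ∈ Icc 0 T, (G t)ᵀ = G t) (h0 : ∀ v, v ≠ 0 → 0 < v ⬝ᵥ G 0 *ᵥ v)
    (hb : ∀ t ∈ Ioo 0 T, ∀ v, v ≠ 0 → G t *ᵥ v = 0 → 0 < v ⬝ᵥ G' t *ᵥ v) :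
    ∀ t ∈ Icc 0 T, ∀ v, 0 ≤ v ⬝ᵥ G t *ᵥ v := by
  have hzero : ∀ v, 0 ≤ v ⬝ᵥ G 0 *ᵥ v := fun v => by
    by_cases hv : v = 0
    · simp [hv]
    · exact (h0 v hv).le
  -- The endpoint `T` is left out because the derivative exists only inside the interval; continuity
  -- recovers it at the end.
  have key : ∀ t ∈ Ico 0 T, ∀ v, 0 ≤ v ⬝ᵥ G t *ᵥ v := by
    intro t₁ ht₁ w
    by_contra! hneg
    have hw : w ≠ 0 := by rintro rfl; simp at hneg
    let q : ℝ × (Fin n → ℝ) → ℝ := fun p => p.2 ⬝ᵥ G p.1 *ᵥ p.2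
    -- By homogeneity unit vectors suffice, and compactness of `D` then yields an earliest time with
    -- a nonpositive value. The sphere is that of the sup norm; any norm would serve.
    let D : Set (ℝ × (Fin n → ℝ)) := Icc 0 t₁ ×ˢ Metric.sphere 0 1
    have hD : IsCompact D := isCompact_Icc.prod (isCompact_sphere _ _)
    have hq : ContinuousOn q D := by
      have h1 : ContinuousOn (fun p : ℝ × (Fin n → ℝ) => G p.1) D :=
        hcont.comp continuousOn_fst fun p hp => ⟨hp.1.1, hp.1.2.trans ht₁.2.le⟩
      exact (by fun_prop : Continuous fun p : Matrix (Fin n) (Fin n) ℝ × (Fin n → ℝ) =>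
        p.2 ⬝ᵥ p.1 *ᵥ p.2).comp_continuousOn (h1.prodMk continuousOn_snd)
    have hK : IsCompact (D ∩ q ⁻¹' Iic 0) :=
      hD.of_isClosed_subset (hq.preimage_isClosed_of_isClosed hD.isClosed isClosed_Iic)
        inter_subset_left
    have hscale : ∀ s, ∀ v : Fin n → ℝ, v ≠ 0 →
        q (s, ‖v‖⁻¹ • v) = ‖v‖⁻¹ * ‖v‖⁻¹ * (v ⬝ᵥ G s *ᵥ v) := by
      intro s v _
      simp [q, Matrix.mulVec_smul, mul_assoc]
    have hunit : ∀ v : Fin n → ℝ, v ≠ 0 → ‖v‖⁻¹ • v ∈ Metric.sphere (0 : Fin n → ℝ) 1 := by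
      intro v hv
      simp [norm_smul, inv_mul_cancel₀ (norm_ne_zero_iff.2 hv)]
    have hne : (D ∩ q ⁻¹' Iic 0).Nonempty := by
      refine ⟨(t₁, ‖w‖⁻¹ • w), ⟨⟨⟨ht₁.1, le_rfl⟩, hunit w hw⟩, ?_⟩⟩
      simp only [mem_preimage, mem_Iic, hscale t₁ w hw]
      exact mul_nonpos_of_nonneg_of_nonpos (by positivity) hneg.le
    obtain ⟨⟨t, v⟩, ⟨⟨htm, hvm⟩, htv⟩, hmin⟩ := hK.exists_isMinOn hne continuousOn_fst
    simp only [mem_preimage, mem_Iic, q] at htv hvm htm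
    have hv : v ≠ 0 := by
      rintro rfl
      simp at hvm
    have htpos : 0 < t := by
      rcases htm.1.eq_or_lt with h | h
      · rw [← h] at htv
        exact absurd (h0 v hv) htv.not_gt
      · exact h
    have htT : t < T := htm.2.trans_lt ht₁.2
    have hbefore : ∀ s ∈ Ico 0 t, ∀ u, 0 ≤ u ⬝ᵥ G s *ᵥ u := by
      intro s hs u
      by_contra! hu
      have hu0 : u ≠ 0 := by rintro rfl; simp at hu
      have hmem : (s, ‖u‖⁻¹ • u) ∈ D ∩ q ⁻¹' Iic 0 := by
        refine ⟨⟨⟨hs.1, hs.2.le.trans htm.2⟩, hunit u hu0⟩, ?_⟩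
        simp only [mem_preimage, mem_Iic, hscale s u hu0]
        exact mul_nonpos_of_nonneg_of_nonpos (by positivity) hu.le
      exact absurd (hmin hmem) (not_le.2 hs.2)
    have hat := quadForm_nonneg_right htpos
      (hcont.mono (Icc_subset_Icc le_rfl htT.le)) hbefore
    have hv0 : v ⬝ᵥ G t *ᵥ v = 0 := le_antisymm htv (hat v)
    have hker := mulVec_eq_zero_of_quadForm_eq_zero (hsymm t ⟨htpos.le, htT.le⟩) hat hv0
    -- The form of `v` is nonnegative before `t` and zero at `t`, so its slopes from the left are
    -- nonpositive, against the strict sign in `hb`.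
    have hd := (hasDerivAt_quadForm (hder t ⟨htpos, htT⟩) v).hasDerivWithinAt (s := Iio t)
    rw [hasDerivWithinAt_iff_tendsto_slope' (by simp)] at hd
    refine absurd (hb t ⟨htpos, htT⟩ v hv hker) (not_lt.2 (le_of_tendsto hd ?_))
    filter_upwards [Ioo_mem_nhdsLT htpos] with s hs
    rw [slope_def_field, hv0, sub_zero]
    exact div_nonpos_of_nonneg_of_nonpos (hbefore s ⟨hs.1.le, hs.2⟩ v) (by linarith [hs.2])
  intro t ht
  rcases ht.1.eq_or_lt with h | h
  · rw [← h]; exact hzero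
  · exact quadForm_nonneg_right h (hcont.mono (Icc_subset_Icc le_rfl ht.2))
      fun s hs => key s ⟨hs.1, hs.2.trans_le ht.2⟩

/-! ### Spectral norm, inverses and quadratic forms -/

lemma dotProduct_self_nonneg' (v : Fin n → ℝ) : 0 ≤ v ⬝ᵥ v := by
  simpa using dotProduct_star_self_nonneg v

lemma dotProduct_self_pos {v : Fin n → ℝ} (hv : v ≠ 0) : 0 < v ⬝ᵥ v :=
  lt_of_le_of_ne (dotProduct_self_nonneg' v) fun h => hv (dotProduct_self_eq_zero.1 h.symm)

lemma transpose_eq_of_isHermitian {A : Matrix (Fin n) (Fin n) ℝ} (hA : A.IsHermitian) :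
    Aᵀ = A := by
  simpa [Matrix.IsHermitian, Matrix.conjTranspose_eq_transpose_of_trivial] using hA

lemma norm_toLp_sq (v : Fin n → ℝ) : ‖WithLp.toLp 2 v‖ ^ 2 = v ⬝ᵥ v := by
  rw [EuclideanSpace.real_norm_sq_eq]
  simp [dotProduct, sq]

lemma abs_dotProduct_le (v w : Fin n → ℝ) :
    |v ⬝ᵥ w| ≤ ‖WithLp.toLp 2 v‖ * ‖WithLp.toLp 2 w‖ := by
  have := abs_real_inner_le_norm (WithLp.toLp 2 w) (WithLp.toLp 2 v)
  simpa [EuclideanSpace.inner_eq_star_dotProduct, mul_comm] using this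

lemma abs_quadForm_le (A : Matrix (Fin n) (Fin n) ℝ) (v : Fin n → ℝ) :
    |v ⬝ᵥ A *ᵥ v| ≤ ‖A‖ * (v ⬝ᵥ v) := by
  refine (abs_dotProduct_le v (A *ᵥ v)).trans ?_
  have h := Matrix.l2_opNorm_mulVec A (WithLp.toLp 2 v)
  simp only at h
  rw [← norm_toLp_sq]
  have := mul_le_mul_of_nonneg_left h (norm_nonneg (WithLp.toLp 2 v))
  refine this.trans (le_of_eq (by ring))

lemma norm_transpose (A : Matrix (Fin n) (Fin m) ℝ) : ‖Aᵀ‖ = ‖A‖ := by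
  rw [← Matrix.conjTranspose_eq_transpose_of_trivial, Matrix.l2_opNorm_conjTranspose]

lemma dotProduct_mulVec_comm {A : Matrix (Fin n) (Fin n) ℝ} (hA : Aᵀ = A) (v w : Fin n → ℝ) :
    w ⬝ᵥ A *ᵥ v = v ⬝ᵥ A *ᵥ w := by
  rw [Matrix.dotProduct_mulVec, ← Matrix.mulVec_transpose, hA, dotProduct_comm]

lemma quadForm_sub_smul {A : Matrix (Fin n) (Fin n) ℝ} (hA : Aᵀ = A) (v w : Fin n → ℝ) (s : ℝ) :
    (v - s • w) ⬝ᵥ A *ᵥ (v - s • w)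
      = v ⬝ᵥ A *ᵥ v - 2 * s * (w ⬝ᵥ A *ᵥ v) + s ^ 2 * (w ⬝ᵥ A *ᵥ w) := by
  simp only [Matrix.mulVec_sub, Matrix.mulVec_smul, dotProduct_sub, sub_dotProduct,
    smul_dotProduct, dotProduct_smul, smul_eq_mul, dotProduct_mulVec_comm hA w v]
  ring

/-- A positive semidefinite matrix whose quadratic form is at most `η` has norm at most `η`. -/
lemma norm_le_of_quadForm_le {A : Matrix (Fin n) (Fin n) ℝ} {η : ℝ} (hη : 0 < η) (hA : Aᵀ = A)
    (h0 : ∀ v, 0 ≤ v ⬝ᵥ A *ᵥ v) (h1 : ∀ v, v ⬝ᵥ A *ᵥ v ≤ η * (v ⬝ᵥ v)) : ‖A‖ ≤ η := by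
  rw [Matrix.cstar_norm_def]
  refine ContinuousLinearMap.opNorm_le_bound _ hη.le fun x => ?_
  obtain ⟨v, rfl⟩ := (WithLp.toLp_surjective 2) x
  rw [Matrix.toEuclideanCLM_toLp]
  -- This test vector gives `2η⁻¹|Av|² ≤ v·Av + η⁻² (Av)·A(Av) ≤ η|v|² + η⁻¹|Av|²`, that is `|Av|² ≤
  -- η²|v|²`.
  have h := h0 (v - η⁻¹ • (A *ᵥ v))
  rw [quadForm_sub_smul hA] at h
  have h2 := h1 v
  have h3 := h1 (A *ᵥ v)
  have h4 : η⁻¹ ^ 2 * (A *ᵥ v ⬝ᵥ A *ᵥ A *ᵥ v) ≤ η⁻¹ * (A *ᵥ v ⬝ᵥ A *ᵥ v) := by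
    refine (mul_le_mul_of_nonneg_left h3 (by positivity)).trans (le_of_eq ?_)
    field_simp
  have h5 : η⁻¹ * (A *ᵥ v ⬝ᵥ A *ᵥ v) ≤ η * (v ⬝ᵥ v) := by linarith
  rw [inv_mul_le_iff₀ hη] at h5
  refine abs_le_of_sq_le_sq' ?_ (by positivity) |>.2
  rw [mul_pow, norm_toLp_sq, norm_toLp_sq]
  linarith [h5, sq η]

/-- A lower bound for the quadratic form of a positive definite matrix by the norm of its
inverse. -/
lemma quadForm_ge_of_norm_inv_le {A : Matrix (Fin n) (Fin n) ℝ} {M : ℝ} (hM : 0 < M)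
    (hA : A.PosDef) (h : ‖A⁻¹‖ ≤ M) (v : Fin n → ℝ) : M⁻¹ * (v ⬝ᵥ v) ≤ v ⬝ᵥ A *ᵥ v := by
  have hsymm := transpose_eq_of_isHermitian hA.1
  have hdet : IsUnit A.det := hA.det_pos.ne'.isUnit
  -- Expanding gives `2M⁻¹|v|² ≤ v·Av + M⁻² v·A⁻¹v`, and the last term is at most `M⁻¹|v|²`.
  have h0 : 0 ≤ (v - M⁻¹ • (A⁻¹ *ᵥ v)) ⬝ᵥ A *ᵥ (v - M⁻¹ • (A⁻¹ *ᵥ v)) := by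
    simpa using hA.posSemidef.dotProduct_mulVec_nonneg (v - M⁻¹ • (A⁻¹ *ᵥ v))
  have hAi : A *ᵥ (A⁻¹ *ᵥ v) = v := by
    rw [Matrix.mulVec_mulVec, Matrix.mul_nonsing_inv _ hdet, Matrix.one_mulVec]
  rw [quadForm_sub_smul hsymm, dotProduct_mulVec_comm hsymm v (A⁻¹ *ᵥ v), hAi,
    dotProduct_comm (A⁻¹ *ᵥ v) v] at h0
  have h1 := (le_abs_self _).trans (abs_quadForm_le A⁻¹ v)
  have h2 := h1.trans (mul_le_mul_of_nonneg_right h (dotProduct_self_nonneg' v))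
  have h4 : M⁻¹ ^ 2 * (v ⬝ᵥ A⁻¹ *ᵥ v) ≤ M⁻¹ * (v ⬝ᵥ v) := by
    refine (mul_le_mul_of_nonneg_left h2 (by positivity)).trans (le_of_eq ?_)
    field_simp
  linarith

/-- The weighted norm for the inverse of a matrix bounded below. -/
lemma weightedNorm_inv_le {A : Matrix (Fin n) (Fin n) ℝ} {ε : ℝ} (hε : 0 < ε)
    (h : ∀ v, ε * (v ⬝ᵥ v) ≤ v ⬝ᵥ A *ᵥ v) (x : EuclideanSpace ℝ (Fin n)) :
    weightedNorm A⁻¹ x ≤ √ε⁻¹ * ‖x‖ := by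
  obtain ⟨v, rfl⟩ := (WithLp.toLp_surjective 2) x
  have hdet : IsUnit A.det := by
    rw [isUnit_iff_ne_zero]
    intro hd
    obtain ⟨w, hw, hAw⟩ := Matrix.exists_mulVec_eq_zero_iff.2 hd
    have h1 := h w
    rw [hAw, dotProduct_zero] at h1
    have h2 := dotProduct_self_pos hw
    nlinarith
  have hAi : A *ᵥ (A⁻¹ *ᵥ v) = v := by
    rw [Matrix.mulVec_mulVec, Matrix.mul_nonsing_inv _ hdet, Matrix.one_mulVec]
  have h1 := h (A⁻¹ *ᵥ v)
  rw [hAi, dotProduct_comm _ v] at h1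
  -- With `w = A⁻¹v`, the bound `ε|w|² ≤ v·w` inserted into `|v - εw|² ≥ 0` leaves `ε v·w ≤ |v|²`.
  have h2 : 0 ≤ (v - ε • (A⁻¹ *ᵥ v)) ⬝ᵥ (v - ε • (A⁻¹ *ᵥ v)) := dotProduct_self_nonneg' _
  simp only [dotProduct_sub, sub_dotProduct, smul_dotProduct, dotProduct_smul, smul_eq_mul,
    dotProduct_comm (A⁻¹ *ᵥ v) v] at h2
  have h3 : v ⬝ᵥ A⁻¹ *ᵥ v ≤ ε⁻¹ * (v ⬝ᵥ v) := by
    rw [le_inv_mul_iff₀ hε]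
    nlinarith
  rw [weightedNorm]
  refine Real.sqrt_le_iff.2 ⟨by positivity, ?_⟩
  rw [mul_pow, Real.sq_sqrt (by positivity), norm_toLp_sq]
  exact h3

/-! ### The matrix Riccati equation -/

/-- Integral form of the matrix Riccati equation. -/
lemma riccati_integral_eq {T : ℝ} {A G W : Matrix (Fin n) (Fin n) ℝ}
    {X : ℝ → Matrix (Fin n) (Fin n) ℝ} (hc : ContinuousOn X (Icc 0 T))
    (hd : ∀ t ∈ Ioo 0 T, HasDerivAt X (A * X t + X t * Aᵀ - X t * G * X t + W) t) :
    ∀ t ∈ Icc 0 T,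
      IntervalIntegrable (fun s => A * X s + X s * Aᵀ - X s * G * X s + W) volume 0 t ∧
      X t = X 0 + ∫ s in (0 : ℝ)..t, (A * X s + X s * Aᵀ - X s * G * X s + W) := by
  intro t ht
  have hc' := hc.mono (Icc_subset_Icc le_rfl ht.2)
  have hi : IntervalIntegrable (fun s => A * X s + X s * Aᵀ - X s * G * X s + W) volume 0 t := by
    refine ContinuousOn.intervalIntegrable ?_
    rw [uIcc_of_le ht.1]
    fun_prop
  refine ⟨hi, ?_⟩
  rw [intervalIntegral.integral_eq_sub_of_hasDerivAt_of_le ht.1 hc'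
    (fun s hs => hd s ⟨hs.1, hs.2.trans_le ht.2⟩) hi]
  abel

/-- Lipschitz dependence of solutions of the matrix Riccati equation on the data. -/
lemma norm_riccati_sub_le {T a g p : ℝ} {A₁ A₂ G₁ G₂ W₁ W₂ : Matrix (Fin n) (Fin n) ℝ}
    {X₁ X₂ : ℝ → Matrix (Fin n) (Fin n) ℝ}
    (hc₁ : ContinuousOn X₁ (Icc 0 T)) (hc₂ : ContinuousOn X₂ (Icc 0 T))
    (hd₁ : ∀ t ∈ Ioo 0 T, HasDerivAt X₁ (A₁ * X₁ t + X₁ t * A₁ᵀ - X₁ t * G₁ * X₁ t + W₁) t)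
    (hd₂ : ∀ t ∈ Ioo 0 T, HasDerivAt X₂ (A₂ * X₂ t + X₂ t * A₂ᵀ - X₂ t * G₂ * X₂ t + W₂) t)
    (ha : ‖A₁‖ ≤ a) (hg : ‖G₁‖ ≤ g) (hp₁ : ∀ t ∈ Icc 0 T, ‖X₁ t‖ ≤ p)
    (hp₂ : ∀ t ∈ Icc 0 T, ‖X₂ t‖ ≤ p) :
    ∀ t ∈ Icc 0 T, ‖X₁ t - X₂ t‖ ≤
      (‖X₁ 0 - X₂ 0‖ + T * (2 * p * ‖A₁ - A₂‖ + p ^ 2 * ‖G₁ - G₂‖ + ‖W₁ - W₂‖))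
        * Real.exp ((2 * a + 2 * p * g) * T) := by
  intro t ht
  have hT : (0 : ℝ) ≤ T := ht.1.trans ht.2
  have hp : 0 ≤ p := (norm_nonneg _).trans (hp₁ t ht)
  have ha0 : 0 ≤ a := (norm_nonneg _).trans ha
  have hg0 : 0 ≤ g := (norm_nonneg _).trans hg
  have := norm_le_of_integral_eq (f := fun t => X₁ t - X₂ t) (f₀ := X₁ 0 - X₂ 0)
    (L := 2 * a + 2 * p * g)
    (g := fun s => (A₁ * X₁ s + X₁ s * A₁ᵀ - X₁ s * G₁ * X₁ s + W₁)
      - (A₂ * X₂ s + X₂ s * A₂ᵀ - X₂ s * G₂ * X₂ s + W₂))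
    (h := fun _ => 2 * p * ‖A₁ - A₂‖ + p ^ 2 * ‖G₁ - G₂‖ + ‖W₁ - W₂‖)
    (by positivity) (hc₁.sub hc₂) ?_ (by simp) (fun _ => by positivity) ?_ t ht
  · rwa [intervalIntegral.integral_const, sub_zero, smul_eq_mul] at this
  · intro s hs
    obtain ⟨hi₁, h₁⟩ := riccati_integral_eq hc₁ hd₁ s hs
    obtain ⟨hi₂, h₂⟩ := riccati_integral_eq hc₂ hd₂ s hs
    rw [intervalIntegral.integral_sub hi₁ hi₂]
    nth_rewrite 1 [h₁, h₂]
    abel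
  · intro s hs
    have hX₁ := hp₁ s (Ioo_subset_Icc_self hs)
    have hX₂ := hp₂ s (Ioo_subset_Icc_self hs)
    set D := X₁ s - X₂ s with hD
    -- Terms linear in `D` form the Grönwall rate `2a + 2pg`; the rest is a source made of data
    -- differences, multiplied by `X₂` alone.
    have hsplit : (A₁ * X₁ s + X₁ s * A₁ᵀ - X₁ s * G₁ * X₁ s + W₁)
        - (A₂ * X₂ s + X₂ s * A₂ᵀ - X₂ s * G₂ * X₂ s + W₂)
        = (A₁ * D + D * A₁ᵀ - D * G₁ * X₁ s - X₂ s * G₁ * D)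
          + ((A₁ - A₂) * X₂ s + X₂ s * (A₁ - A₂)ᵀ - X₂ s * (G₁ - G₂) * X₂ s + (W₁ - W₂)) := by
      rw [hD, Matrix.transpose_sub]
      noncomm_ring
    have e1 : ‖A₁ * D‖ ≤ a * ‖D‖ :=
      (norm_mul_le _ _).trans (by gcongr)
    have e2 : ‖D * A₁ᵀ‖ ≤ ‖D‖ * a :=
      (norm_mul_le _ _).trans (by rw [norm_transpose]; gcongr)
    have e3 : ‖D * G₁ * X₁ s‖ ≤ ‖D‖ * g * p :=
      (norm_mul₃_le).trans (by gcongr)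
    have e4 : ‖X₂ s * G₁ * D‖ ≤ p * g * ‖D‖ :=
      (norm_mul₃_le).trans (by gcongr)
    have e5 : ‖(A₁ - A₂) * X₂ s‖ ≤ ‖A₁ - A₂‖ * p :=
      (norm_mul_le _ _).trans (by gcongr)
    have e6 : ‖X₂ s * (A₁ - A₂)ᵀ‖ ≤ p * ‖A₁ - A₂‖ :=
      (norm_mul_le _ _).trans (by rw [norm_transpose]; gcongr)
    have e7 : ‖X₂ s * (G₁ - G₂) * X₂ s‖ ≤ p * ‖G₁ - G₂‖ * p :=
      (norm_mul₃_le).trans (by gcongr)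
    rw [hsplit]
    have f1 := norm_add_le (A₁ * D + D * A₁ᵀ - D * G₁ * X₁ s - X₂ s * G₁ * D)
      ((A₁ - A₂) * X₂ s + X₂ s * (A₁ - A₂)ᵀ - X₂ s * (G₁ - G₂) * X₂ s + (W₁ - W₂))
    have f2 := norm_sub_le (A₁ * D + D * A₁ᵀ - D * G₁ * X₁ s) (X₂ s * G₁ * D)
    have f3 := norm_sub_le (A₁ * D + D * A₁ᵀ) (D * G₁ * X₁ s)
    have f4 := norm_add_le (A₁ * D) (D * A₁ᵀ)
    have f5 := norm_add_le ((A₁ - A₂) * X₂ s + X₂ s * (A₁ - A₂)ᵀ - X₂ s * (G₁ - G₂) * X₂ s)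
      (W₁ - W₂)
    have f6 := norm_sub_le ((A₁ - A₂) * X₂ s + X₂ s * (A₁ - A₂)ᵀ) (X₂ s * (G₁ - G₂) * X₂ s)
    have f7 := norm_add_le ((A₁ - A₂) * X₂ s) (X₂ s * (A₁ - A₂)ᵀ)
    linarith

/-- Solutions of the matrix Riccati equation with symmetric data are symmetric. -/
lemma riccati_transpose_eq {T : ℝ} {A G W : Matrix (Fin n) (Fin n) ℝ}
    {X : ℝ → Matrix (Fin n) (Fin n) ℝ} (hc : ContinuousOn X (Icc 0 T))
    (hd : ∀ t ∈ Ioo 0 T, HasDerivAt X (A * X t + X t * Aᵀ - X t * G * X t + W) t)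
    (hG : Gᵀ = G) (hW : Wᵀ = W) (h0 : (X 0)ᵀ = X 0) :
    ∀ t ∈ Icc 0 T, (X t)ᵀ = X t := by
  intro t ht
  obtain ⟨p, hp⟩ := isCompact_Icc.exists_bound_of_continuousOn hc
  -- The transpose solves the same equation with the same initial value, and the Lipschitz estimate
  -- with zero data difference is uniqueness.
  have hd' : ∀ t ∈ Ioo 0 T, HasDerivAt (fun t => (X t)ᵀ)
      (A * (X t)ᵀ + (X t)ᵀ * Aᵀ - (X t)ᵀ * G * (X t)ᵀ + W) t := by
    intro s hs
    have h1 := (LinearMap.toContinuousLinearMap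
      (Matrix.transposeLinearEquiv (Fin n) (Fin n) ℝ ℝ).toLinearMap).hasFDerivAt.comp_hasDerivAt
        s (hd s hs)
    refine h1.congr_deriv ?_
    simp [Matrix.transpose_mul, hG, hW, Matrix.mul_assoc, add_comm]
  have := norm_riccati_sub_le hc (X₂ := fun t => (X t)ᵀ) (by fun_prop) hd hd' le_rfl le_rfl hp
    (fun s hs => by rw [norm_transpose]; exact hp s hs) t ht
  simp only [h0, sub_self, norm_zero, mul_zero, add_zero, zero_mul, norm_le_zero_iff] at this
  exact (sub_eq_zero.1 this).symm

lemma quadForm_smul_one (c : ℝ) (v : Fin n → ℝ) :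
    v ⬝ᵥ (c • (1 : Matrix (Fin n) (Fin n) ℝ)) *ᵥ v = c * (v ⬝ᵥ v) := by
  simp [Matrix.smul_mulVec]

/-- The right-hand side of the Riccati equation on an eigenvector of the solution. -/
lemma riccati_quadForm_of_mulVec_eq {A G W X : Matrix (Fin n) (Fin n) ℝ} (hX : Xᵀ = X)
    {l : ℝ} {v : Fin n → ℝ} (hv : X *ᵥ v = l • v) :
    v ⬝ᵥ (A * X + X * Aᵀ - X * G * X + W) *ᵥ v
      = 2 * l * (v ⬝ᵥ A *ᵥ v) - l ^ 2 * (v ⬝ᵥ G *ᵥ v) + v ⬝ᵥ W *ᵥ v := by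
  have hl : ∀ w, v ⬝ᵥ X *ᵥ w = l * (v ⬝ᵥ w) := fun w => by
    rw [dotProduct_mulVec_comm hX, hv, dotProduct_smul, smul_eq_mul, dotProduct_comm]
  have hA : v ⬝ᵥ Aᵀ *ᵥ v = v ⬝ᵥ A *ᵥ v := by
    rw [Matrix.mulVec_transpose, dotProduct_comm, ← Matrix.dotProduct_mulVec]
  rw [Matrix.add_mulVec, Matrix.sub_mulVec, Matrix.add_mulVec, dotProduct_add, dotProduct_sub,
    dotProduct_add, ← Matrix.mulVec_mulVec, ← Matrix.mulVec_mulVec, ← Matrix.mulVec_mulVec,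
    ← Matrix.mulVec_mulVec, hl, hl, hv, Matrix.mulVec_smul, Matrix.mulVec_smul, dotProduct_smul,
    dotProduct_smul, hA]
  simp only [smul_eq_mul]
  ring

/-- A priori lower bound for solutions of the matrix Riccati equation. -/
lemma riccati_quadForm_ge {T a g δ : ℝ} {A G W : Matrix (Fin n) (Fin n) ℝ}
    {X : ℝ → Matrix (Fin n) (Fin n) ℝ} (hc : ContinuousOn X (Icc 0 T))
    (hd : ∀ t ∈ Ioo 0 T, HasDerivAt X (A * X t + X t * Aᵀ - X t * G * X t + W) t)
    (hsymm : ∀ t ∈ Icc 0 T, (X t)ᵀ = X t) (ha : ‖A‖ ≤ a) (hg : ‖G‖ ≤ g)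
    (hW : ∀ v, 0 ≤ v ⬝ᵥ W *ᵥ v) (hδ : 0 < δ) (hδ1 : δ ≤ 1)
    (h0 : ∀ v, v ≠ 0 → δ * (v ⬝ᵥ v) < v ⬝ᵥ X 0 *ᵥ v) :
    ∀ t ∈ Icc 0 T, ∀ v, δ * Real.exp (-((2 * a + g + 1) * T)) * (v ⬝ᵥ v) ≤ v ⬝ᵥ X t *ᵥ v := by
  have ha0 : 0 ≤ a := (norm_nonneg _).trans ha
  have hg0 : 0 ≤ g := (norm_nonneg _).trans hg
  -- At a contact `Xv = εv` the gap has derivative at least `(κε - 2aε - gε²)|v|²`. Since `ε ≤ 1`,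
  -- this is at least `ε|v|²`; the summand `1` in `κ` provides strictness.
  set κ := 2 * a + g + 1 with hκ
  let ε : ℝ → ℝ := fun t => δ * Real.exp (-(κ * t))
  have hε : ∀ t, HasDerivAt ε (-κ * ε t) t := fun t => by
    have := ((((hasDerivAt_id t).const_mul κ).neg).exp).const_mul δ
    refine this.congr_deriv ?_
    simp only [ε, id, Pi.neg_apply]
    ring
  have hεc : Continuous ε := by simp only [ε]; fun_prop
  have key := quadForm_nonneg_of_barrier (T := T)
    (G := fun t => X t - ε t • (1 : Matrix (Fin n) (Fin n) ℝ))
    (G' := fun t => (A * X t + X t * Aᵀ - X t * G * X t + W)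
      - (-κ * ε t) • (1 : Matrix (Fin n) (Fin n) ℝ)) (by fun_prop)
    (fun t ht => (hd t ht).sub ((hε t).smul_const _))
    (fun t ht => by simp [hsymm t ht]) ?_ ?_
  · intro t ht v
    have h1 := key t ht v
    rw [Matrix.sub_mulVec, dotProduct_sub, quadForm_smul_one] at h1
    have h2 : δ * Real.exp (-(κ * T)) ≤ ε t := by
      have : κ * t ≤ κ * T := mul_le_mul_of_nonneg_left ht.2 (by positivity)
      simp only [ε]
      gcongr
    linarith [mul_le_mul_of_nonneg_right h2 (dotProduct_self_nonneg' v)]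
  · intro v hv
    rw [Matrix.sub_mulVec, dotProduct_sub, quadForm_smul_one]
    simpa [ε] using h0 v hv
  · intro t ht v hv hker
    have hε0 : 0 < ε t := by simp only [ε]; positivity
    have hε1 : ε t ≤ 1 := by
      have : Real.exp (-(κ * t)) ≤ 1 :=
        Real.exp_le_one_iff.2 (neg_nonpos.2 (mul_nonneg (by positivity) ht.1.le))
      simp only [ε]
      nlinarith [Real.exp_pos (-(κ * t))]
    have hXv : X t *ᵥ v = ε t • v := by
      rw [Matrix.sub_mulVec, sub_eq_zero, Matrix.smul_mulVec, Matrix.one_mulVec] at hker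
      exact hker
    rw [Matrix.sub_mulVec, dotProduct_sub, quadForm_smul_one,
      riccati_quadForm_of_mulVec_eq (hsymm t (Ioo_subset_Icc_self ht)) hXv]
    have hvv := dotProduct_self_pos hv
    have hA := (abs_le.1 ((abs_quadForm_le A v).trans
      (mul_le_mul_of_nonneg_right ha hvv.le))).1
    have hG := (abs_le.1 ((abs_quadForm_le G v).trans
      (mul_le_mul_of_nonneg_right hg hvv.le))).2
    have e1 := mul_le_mul_of_nonneg_left hA hε0.le
    have e2 := mul_le_mul_of_nonneg_left hG (sq_nonneg (ε t))
    have e3 : ε t ^ 2 * (g * (v ⬝ᵥ v)) ≤ ε t * (g * (v ⬝ᵥ v)) :=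
      mul_le_mul_of_nonneg_right (by nlinarith) (by positivity)
    have e4 : 0 < ε t * (v ⬝ᵥ v) := by positivity
    have e5 := hW v
    rw [hκ]
    linarith

/-- A priori upper bound for solutions of the matrix Riccati equation. -/
lemma riccati_quadForm_le {T a w K : ℝ} {A G W : Matrix (Fin n) (Fin n) ℝ}
    {X : ℝ → Matrix (Fin n) (Fin n) ℝ} (hc : ContinuousOn X (Icc 0 T))
    (hd : ∀ t ∈ Ioo 0 T, HasDerivAt X (A * X t + X t * Aᵀ - X t * G * X t + W) t)
    (hsymm : ∀ t ∈ Icc 0 T, (X t)ᵀ = X t) (ha : ‖A‖ ≤ a) (hw : ‖W‖ ≤ w)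
    (hG : ∀ v, 0 ≤ v ⬝ᵥ G *ᵥ v) (hK : 1 ≤ K)
    (h0 : ∀ v, v ≠ 0 → v ⬝ᵥ X 0 *ᵥ v < K * (v ⬝ᵥ v)) :
    ∀ t ∈ Icc 0 T, ∀ v, v ⬝ᵥ X t *ᵥ v ≤ K * Real.exp ((2 * a + w + 1) * T) * (v ⬝ᵥ v) := by
  have ha0 : 0 ≤ a := (norm_nonneg _).trans ha
  have hw0 : 0 ≤ w := (norm_nonneg _).trans hw
  -- At a contact `Xv = ηv` the gap has derivative at least `(κη - 2aη - w)|v|²`, the quadratic term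
  -- having the favourable sign. Since `η ≥ 1`, the source `w` is absorbed by `wη`.
  set κ := 2 * a + w + 1 with hκ
  let η : ℝ → ℝ := fun t => K * Real.exp (κ * t)
  have hη : ∀ t, HasDerivAt η (κ * η t) t := fun t => by
    have := ((((hasDerivAt_id t).const_mul κ)).exp).const_mul K
    refine this.congr_deriv ?_
    simp only [η, id]
    ring
  have hηc : Continuous η := by simp only [η]; fun_prop
  have key := quadForm_nonneg_of_barrier (T := T)
    (G := fun t => η t • (1 : Matrix (Fin n) (Fin n) ℝ) - X t)
    (G' := fun t => (κ * η t) • (1 : Matrix (Fin n) (Fin n) ℝ)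
      - (A * X t + X t * Aᵀ - X t * G * X t + W)) (by fun_prop)
    (fun t ht => ((hη t).smul_const _).sub (hd t ht))
    (fun t ht => by simp [hsymm t ht]) ?_ ?_
  · intro t ht v
    have h1 := key t ht v
    rw [Matrix.sub_mulVec, dotProduct_sub, quadForm_smul_one] at h1
    have h2 : η t ≤ K * Real.exp (κ * T) := by
      have : κ * t ≤ κ * T := mul_le_mul_of_nonneg_left ht.2 (by positivity)
      simp only [η]
      gcongr
    linarith [mul_le_mul_of_nonneg_right h2 (dotProduct_self_nonneg' v)]
  · intro v hv
    rw [Matrix.sub_mulVec, dotProduct_sub, quadForm_smul_one]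
    simpa [η] using h0 v hv
  · intro t ht v hv hker
    have hη1 : 1 ≤ η t := by
      have : 1 ≤ Real.exp (κ * t) := Real.one_le_exp (mul_nonneg (by positivity) ht.1.le)
      simp only [η]
      nlinarith
    have hXv : X t *ᵥ v = η t • v := by
      rw [Matrix.sub_mulVec, sub_eq_zero, Matrix.smul_mulVec, Matrix.one_mulVec] at hker
      exact hker.symm
    rw [Matrix.sub_mulVec, dotProduct_sub, quadForm_smul_one,
      riccati_quadForm_of_mulVec_eq (hsymm t (Ioo_subset_Icc_self ht)) hXv]
    have hvv := dotProduct_self_pos hv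
    have hA := (abs_le.1 ((abs_quadForm_le A v).trans
      (mul_le_mul_of_nonneg_right ha hvv.le))).2
    have hW := (abs_le.1 ((abs_quadForm_le W v).trans
      (mul_le_mul_of_nonneg_right hw hvv.le))).2
    have e1 := mul_le_mul_of_nonneg_left hA (zero_le_one.trans hη1)
    have e2 := mul_nonneg (sq_nonneg (η t)) (hG v)
    have e3 : 1 * (w * (v ⬝ᵥ v)) ≤ η t * (w * (v ⬝ᵥ v)) :=
      mul_le_mul_of_nonneg_right hη1 (by positivity)
    have e4 : 0 < η t * (v ⬝ᵥ v) := by positivity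
    rw [hκ]
    linarith

/-! ### Riccati bounds uniform over admissible data -/

/-- Admissible data: the covariances are symmetric positive definite and all matrices are
bounded by `M`. -/
structure Sys.IsAdmissible (S : Sys n m r) (M : ℝ) : Prop where
  Γ_posDef : S.Γ.PosDef
  R_posDef : S.R.PosDef
  Q_posDef : S.Q.PosDef
  norm_A : ‖S.A‖ ≤ M
  norm_Γ : ‖S.Γ‖ ≤ M
  norm_R : ‖S.R‖ ≤ M
  norm_Γ_inv : ‖S.Γ⁻¹‖ ≤ M
  norm_Q_inv : ‖S.Q⁻¹‖ ≤ M

lemma quadForm_nonneg {A : Matrix (Fin n) (Fin n) ℝ} (hA : A.PosSemidef) (v : Fin n → ℝ) :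
    0 ≤ v ⬝ᵥ A *ᵥ v := by
  simpa using hA.dotProduct_mulVec_nonneg v

lemma norm_mul₃_le' {l k : ℕ} (A : Matrix (Fin n) (Fin m) ℝ) (B : Matrix (Fin m) (Fin l) ℝ)
    (C : Matrix (Fin l) (Fin k) ℝ) : ‖A * B * C‖ ≤ ‖A‖ * ‖B‖ * ‖C‖ :=
  (Matrix.l2_opNorm_mul _ _).trans
    (mul_le_mul_of_nonneg_right (Matrix.l2_opNorm_mul _ _) (norm_nonneg _))

/-- Reassociation to the shape `X G X` with `G = Cᵀ Q⁻¹ C`, on which the abstract Riccati lemmas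
act. -/
lemma IsRiccatiSolution.hasDerivAt' {T : ℝ} {B : Matrix (Fin n) (Fin m) ℝ}
    {C : Matrix (Fin r) (Fin n) ℝ} {S : Sys n m r} {X : ℝ → Matrix (Fin n) (Fin n) ℝ}
    (h : IsRiccatiSolution T B C S X) : ∀ t ∈ Ioo 0 T, HasDerivAt X
      (S.A * X t + X t * S.Aᵀ - X t * (Cᵀ * S.Q⁻¹ * C) * X t + B * S.R * Bᵀ) t := by
  intro t ht
  simpa only [Matrix.mul_assoc] using h.hasDerivAt t ht

lemma norm_transpose_mul_mul_le (C : Matrix (Fin r) (Fin n) ℝ) (Q : Matrix (Fin r) (Fin r) ℝ) :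
    ‖Cᵀ * Q * C‖ ≤ ‖C‖ ^ 2 * ‖Q‖ := by
  refine (norm_mul₃_le' _ _ _).trans (le_of_eq ?_)
  rw [norm_transpose]; ring

lemma norm_mul_mul_transpose_le (B : Matrix (Fin n) (Fin m) ℝ) (R : Matrix (Fin m) (Fin m) ℝ) :
    ‖B * R * Bᵀ‖ ≤ ‖B‖ ^ 2 * ‖R‖ := by
  refine (norm_mul₃_le' _ _ _).trans (le_of_eq ?_)
  rw [norm_transpose]; ring

/-- Solutions of the Riccati equation are positive definite and bounded above and below,
uniformly over all admissible data. -/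
lemma exists_riccati_bounds (T : ℝ) (B : Matrix (Fin n) (Fin m) ℝ)
    (C : Matrix (Fin r) (Fin n) ℝ) {M : ℝ} (hM : 1 ≤ M) :
    ∃ ε > 0, ∃ p > 0, ∀ (S : Sys n m r), S.IsAdmissible M →
      ∀ X, IsRiccatiSolution T B C S X → ∀ t ∈ Icc 0 T,
        (∀ v, ε * (v ⬝ᵥ v) ≤ v ⬝ᵥ X t *ᵥ v) ∧ ‖X t‖ ≤ p := by
  have hM0 : 0 < M := zero_lt_one.trans_le hM
  -- The initial value satisfies `M⁻¹ I ≤ Γ ≤ M I`; the factor `2⁻¹` and the shift `M + 1` make both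
  -- comparisons strict at time zero, as the barrier requires.
  refine ⟨2⁻¹ * M⁻¹ * Real.exp (-((2 * M + ‖C‖ ^ 2 * M + 1) * T)), by positivity,
    (M + 1) * Real.exp ((2 * M + ‖B‖ ^ 2 * M + 1) * T), by positivity, ?_⟩
  intro S hS X hX
  have hGp : (Cᵀ * S.Q⁻¹ * C).PosSemidef := by
    simpa [Matrix.conjTranspose_eq_transpose_of_trivial] using
      hS.Q_posDef.inv.posSemidef.conjTranspose_mul_mul_same C
  have hWp : (B * S.R * Bᵀ).PosSemidef := by
    simpa [Matrix.conjTranspose_eq_transpose_of_trivial] using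
      hS.R_posDef.posSemidef.mul_mul_conjTranspose_same B
  have hGn : ‖Cᵀ * S.Q⁻¹ * C‖ ≤ ‖C‖ ^ 2 * M :=
    (norm_transpose_mul_mul_le _ _).trans
      (mul_le_mul_of_nonneg_left hS.norm_Q_inv (by positivity))
  have hWn : ‖B * S.R * Bᵀ‖ ≤ ‖B‖ ^ 2 * M :=
    (norm_mul_mul_transpose_le _ _).trans
      (mul_le_mul_of_nonneg_left hS.norm_R (by positivity))
  have hsymm := riccati_transpose_eq hX.continuousOn hX.hasDerivAt'
    (transpose_eq_of_isHermitian hGp.1) (transpose_eq_of_isHermitian hWp.1)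
    (by rw [hX.initial]; exact transpose_eq_of_isHermitian hS.Γ_posDef.1)
  have hlow := riccati_quadForm_ge (δ := 2⁻¹ * M⁻¹) hX.continuousOn hX.hasDerivAt' hsymm hS.norm_A
    hGn (quadForm_nonneg hWp) (by positivity)
    (by have := inv_le_one_of_one_le₀ hM; linarith) (by
      intro v hv
      rw [hX.initial]
      refine lt_of_lt_of_le ?_ (quadForm_ge_of_norm_inv_le hM0 hS.Γ_posDef hS.norm_Γ_inv v)
      have : 0 < M⁻¹ * (v ⬝ᵥ v) := mul_pos (by positivity) (dotProduct_self_pos hv)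
      linarith)
  have hup := riccati_quadForm_le (K := M + 1) hX.continuousOn hX.hasDerivAt' hsymm hS.norm_A
    hWn (quadForm_nonneg hGp) (by linarith) (by
      intro v hv
      rw [hX.initial]
      have hvv := dotProduct_self_pos hv
      have h1 := (le_abs_self _).trans ((abs_quadForm_le S.Γ v).trans
        (mul_le_mul_of_nonneg_right hS.norm_Γ hvv.le))
      linarith)
  intro t ht
  refine ⟨hlow t ht, norm_le_of_quadForm_le (by positivity) (hsymm t ht) (fun v => ?_) (hup t ht)⟩
  exact (mul_nonneg (by positivity) (dotProduct_self_nonneg' v)).trans (hlow t ht v)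

/-- The resolvent identity `Q₁⁻¹ - Q₂⁻¹ = Q₁⁻¹ (Q₂ - Q₁) Q₂⁻¹`. -/
lemma norm_inv_sub_inv_le {Q₁ Q₂ : Matrix (Fin r) (Fin r) ℝ} {M : ℝ} (h₁ : Q₁.PosDef)
    (h₂ : Q₂.PosDef) (hn₁ : ‖Q₁⁻¹‖ ≤ M) (hn₂ : ‖Q₂⁻¹‖ ≤ M) :
    ‖Q₁⁻¹ - Q₂⁻¹‖ ≤ M ^ 2 * ‖Q₁ - Q₂‖ := by
  have hM : 0 ≤ M := (norm_nonneg _).trans hn₁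
  have hd₁ : IsUnit Q₁.det := h₁.det_pos.ne'.isUnit
  have hd₂ : IsUnit Q₂.det := h₂.det_pos.ne'.isUnit
  have heq : Q₁⁻¹ - Q₂⁻¹ = Q₁⁻¹ * (Q₂ - Q₁) * Q₂⁻¹ := by
    rw [Matrix.mul_sub, Matrix.sub_mul, Matrix.nonsing_inv_mul _ hd₁, Matrix.mul_assoc,
      Matrix.mul_nonsing_inv _ hd₂, Matrix.mul_one, Matrix.one_mul]
  rw [heq, norm_sub_rev Q₁ Q₂]
  refine (norm_mul₃_le' _ _ _).trans ?_
  calc ‖Q₁⁻¹‖ * ‖Q₂ - Q₁‖ * ‖Q₂⁻¹‖ ≤ M * ‖Q₂ - Q₁‖ * M := by gcongr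
    _ = M ^ 2 * ‖Q₂ - Q₁‖ := by ring

/-- Solutions of the Riccati equation depend on the data in a Lipschitz continuous way,
uniformly over all admissible data. -/
lemma exists_riccati_lipschitz (T : ℝ) (hT : 0 < T) (B : Matrix (Fin n) (Fin m) ℝ)
    (C : Matrix (Fin r) (Fin n) ℝ) {M : ℝ} (hM : 1 ≤ M) :
    ∃ c > 0, ∀ (S S' : Sys n m r), S.IsAdmissible M → S'.IsAdmissible M →
      ∀ X X', IsRiccatiSolution T B C S X → IsRiccatiSolution T B C S' X' →
        ∀ t ∈ Icc 0 T, ‖X t - X' t‖ ≤ c * (S - S').norm1 := by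
  obtain ⟨ε, hε, p, hp, hb⟩ := exists_riccati_bounds T B C hM
  have hM0 : 0 < M := zero_lt_one.trans_le hM
  set E := Real.exp ((2 * M + 2 * p * (‖C‖ ^ 2 * M)) * T) with hE
  have hE0 : 0 < E := Real.exp_pos _
  -- The summands bound, in order, the contributions of the differences in `Γ`, `A`, `Q` and `R`.
  refine ⟨(1 + T * (2 * p + p ^ 2 * (‖C‖ ^ 2 * M ^ 2) + ‖B‖ ^ 2)) * E, by positivity, ?_⟩
  intro S S' hS hS' X X' hX hX' t ht
  have h := norm_riccati_sub_le hX.continuousOn hX'.continuousOn hX.hasDerivAt' hX'.hasDerivAt'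
    hS.norm_A ((norm_transpose_mul_mul_le C S.Q⁻¹).trans
      (mul_le_mul_of_nonneg_left hS.norm_Q_inv (by positivity)))
    (fun t ht => (hb S hS X hX t ht).2) (fun t ht => (hb S' hS' X' hX' t ht).2) t ht
  rw [hX.initial, hX'.initial, ← hE] at h
  have hG : ‖Cᵀ * S.Q⁻¹ * C - Cᵀ * S'.Q⁻¹ * C‖ ≤ ‖C‖ ^ 2 * (M ^ 2 * ‖S.Q - S'.Q‖) := by
    rw [← Matrix.sub_mul, ← Matrix.mul_sub]
    exact (norm_transpose_mul_mul_le _ _).trans (mul_le_mul_of_nonneg_left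
      (norm_inv_sub_inv_le hS.Q_posDef hS'.Q_posDef hS.norm_Q_inv hS'.norm_Q_inv) (by positivity))
  have hW : ‖B * S.R * Bᵀ - B * S'.R * Bᵀ‖ ≤ ‖B‖ ^ 2 * ‖S.R - S'.R‖ := by
    rw [← Matrix.sub_mul, ← Matrix.mul_sub]
    exact norm_mul_mul_transpose_le _ _
  have hN : (S - S').norm1 = ‖S.A - S'.A‖ + ‖S.Γ - S'.Γ‖ + ‖S.R - S'.R‖ + ‖S.Q - S'.Q‖ := rfl
  have nA := norm_nonneg (S.A - S'.A)
  have nΓ := norm_nonneg (S.Γ - S'.Γ)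
  have nR := norm_nonneg (S.R - S'.R)
  have nQ := norm_nonneg (S.Q - S'.Q)
  refine h.trans ?_
  calc _ ≤ ((S - S').norm1 + T * (2 * p * (S - S').norm1
        + p ^ 2 * (‖C‖ ^ 2 * (M ^ 2 * (S - S').norm1)) + ‖B‖ ^ 2 * (S - S').norm1)) * E := by
        refine mul_le_mul_of_nonneg_right ?_ hE0.le
        have i1 : ‖S.A - S'.A‖ ≤ (S - S').norm1 := by rw [hN]; linarith
        have i2 : ‖S.Γ - S'.Γ‖ ≤ (S - S').norm1 := by rw [hN]; linarith
        have i3 : ‖S.R - S'.R‖ ≤ (S - S').norm1 := by rw [hN]; linarith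
        have i4 : ‖S.Q - S'.Q‖ ≤ (S - S').norm1 := by rw [hN]; linarith
        gcongr
        · exact hG.trans (by gcongr)
        · exact hW.trans (by gcongr)
    _ = _ := by ring

/-! ### The filter equation -/

lemma norm_toEuclideanLin_le (A : Matrix (Fin n) (Fin m) ℝ) (x : EuclideanSpace ℝ (Fin m)) :
    ‖Matrix.toEuclideanLin A x‖ ≤ ‖A‖ * ‖x‖ :=
  Matrix.l2_opNorm_mulVec A x

/-- Applying a matrix to a vector is a continuous bilinear map. Needed because `y` is merely
measurable, so continuity of the integrand is not available. -/
lemma aestronglyMeasurable_toEuclideanLin {μ : Measure ℝ} {K : ℝ → Matrix (Fin n) (Fin m) ℝ}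
    {z : ℝ → EuclideanSpace ℝ (Fin m)} (hK : AEStronglyMeasurable K μ)
    (hz : AEStronglyMeasurable z μ) :
    AEStronglyMeasurable (fun s => Matrix.toEuclideanLin (K s) (z s)) μ := by
  let φ : Matrix (Fin n) (Fin m) ℝ →ₗ[ℝ]
      (EuclideanSpace ℝ (Fin m) →L[ℝ] EuclideanSpace ℝ (Fin n)) :=
    LinearMap.toContinuousLinearMap.toLinearMap ∘ₗ Matrix.toEuclideanLin.toLinearMap
  exact (LinearMap.toContinuousLinearMap φ).aestronglyMeasurable_comp₂ hK hz

lemma continuousOn_toEuclideanLin {s : Set ℝ} {x : ℝ → EuclideanSpace ℝ (Fin m)}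
    (D : Matrix (Fin n) (Fin m) ℝ) (hx : ContinuousOn x s) :
    ContinuousOn (fun t => Matrix.toEuclideanLin D (x t)) s := by
  have h : Continuous fun v => Matrix.toEuclideanLin D v :=
    (Matrix.toEuclideanLin D).continuous_of_finiteDimensional
  exact h.comp_continuousOn hx

/-- The right-hand side of the filter equation is integrable. -/
lemma intervalIntegrable_filter {T t k : ℝ} {A : Matrix (Fin n) (Fin n) ℝ}
    {C : Matrix (Fin r) (Fin n) ℝ} {K : ℝ → Matrix (Fin n) (Fin r) ℝ}
    {x : ℝ → EuclideanSpace ℝ (Fin n)} {y : ℝ → EuclideanSpace ℝ (Fin r)}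
    (hy : IntervalIntegrable y volume 0 T) (hx : ContinuousOn x (Icc 0 T))
    (hK : ContinuousOn K (Icc 0 T)) (hk : ∀ s ∈ Icc 0 T, ‖K s‖ ≤ k) (ht : t ∈ Icc 0 T) :
    IntervalIntegrable (fun s => Matrix.toEuclideanLin A (x s)
      + Matrix.toEuclideanLin (K s) (y s - Matrix.toEuclideanLin C (x s))) volume 0 t := by
  have hsub : Icc 0 t ⊆ Icc 0 T := Icc_subset_Icc le_rfl ht.2
  have hlini : ∀ (l : ℕ) (D : Matrix (Fin l) (Fin n) ℝ),
      IntervalIntegrable (fun s => Matrix.toEuclideanLin D (x s)) volume 0 t := by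
    intro l D
    refine ((continuousOn_toEuclideanLin D hx).mono ?_).intervalIntegrable
    rwa [uIcc_of_le ht.1]
  have hyi : IntervalIntegrable y volume 0 t := hy.mono_set (by
    rwa [uIcc_of_le ht.1, uIcc_of_le (ht.1.trans ht.2)])
  refine (hlini n A).add ?_
  set z : ℝ → EuclideanSpace ℝ (Fin r) := fun s => y s - Matrix.toEuclideanLin C (x s)
  have hz : IntervalIntegrable z volume 0 t := hyi.sub (hlini r C)
  rw [intervalIntegrable_iff_integrableOn_Ioc_of_le ht.1] at hz ⊢
  have hKm : AEStronglyMeasurable K (volume.restrict (Ioc 0 t)) :=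
    (hK.mono (Ioc_subset_Icc_self.trans hsub)).aestronglyMeasurable measurableSet_Ioc
  have hm : AEStronglyMeasurable (fun s => Matrix.toEuclideanLin (K s) (z s))
      (volume.restrict (Ioc 0 t)) :=
    aestronglyMeasurable_toEuclideanLin hKm hz.1
  refine Integrable.mono' (hz.norm.const_mul k) hm ?_
  refine (ae_restrict_iff' measurableSet_Ioc).2 (Filter.Eventually.of_forall fun s hs => ?_)
  exact (norm_toEuclideanLin_le _ _).trans
    (mul_le_mul_of_nonneg_right (hk s (hsub (Ioc_subset_Icc_self hs))) (norm_nonneg _))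

/-- A priori bound for the solution of a linear filter equation. -/
lemma norm_filter_le {T a k : ℝ} {A : Matrix (Fin n) (Fin n) ℝ}
    {C : Matrix (Fin r) (Fin n) ℝ} {K : ℝ → Matrix (Fin n) (Fin r) ℝ}
    {x₀ : EuclideanSpace ℝ (Fin n)} {x : ℝ → EuclideanSpace ℝ (Fin n)}
    {y : ℝ → EuclideanSpace ℝ (Fin r)}
    (hy : IntervalIntegrable y volume 0 T) (hx : ContinuousOn x (Icc 0 T))
    (heq : ∀ t ∈ Icc 0 T, x t = x₀ + ∫ s in (0 : ℝ)..t, (Matrix.toEuclideanLin A (x s)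
      + Matrix.toEuclideanLin (K s) (y s - Matrix.toEuclideanLin C (x s))))
    (ha : ‖A‖ ≤ a) (hk0 : 0 ≤ k) (hk : ∀ s ∈ Icc 0 T, ‖K s‖ ≤ k) :
    ∀ t ∈ Icc 0 T, ‖x t‖ ≤ (‖x₀‖ + k * ∫ s in (0 : ℝ)..T, ‖y s‖)
      * Real.exp ((a + k * ‖C‖) * T) := by
  have ha0 : 0 ≤ a := (norm_nonneg _).trans ha
  have := norm_le_of_integral_eq (L := a + k * ‖C‖) (h := fun s => k * ‖y s‖) (by positivity) hx
    heq (hy.norm.const_mul k) (fun _ => by positivity) ?_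
  · simpa only [intervalIntegral.integral_const_mul] using this
  · intro s hs
    have e1 : ‖Matrix.toEuclideanLin A (x s)‖ ≤ a * ‖x s‖ :=
      (norm_toEuclideanLin_le _ _).trans (by gcongr)
    have e2 : ‖y s - Matrix.toEuclideanLin C (x s)‖ ≤ ‖y s‖ + ‖C‖ * ‖x s‖ :=
      (norm_sub_le _ _).trans (add_le_add_right (norm_toEuclideanLin_le _ _) _)
    have e3 : ‖Matrix.toEuclideanLin (K s) (y s - Matrix.toEuclideanLin C (x s))‖
        ≤ k * (‖y s‖ + ‖C‖ * ‖x s‖) :=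
      (norm_toEuclideanLin_le _ _).trans
        (mul_le_mul (hk s (Ioo_subset_Icc_self hs)) e2 (norm_nonneg _) hk0)
    refine (norm_add_le _ _).trans ((add_le_add e1 e3).trans (le_of_eq ?_))
    ring

/-- Lipschitz dependence of the solution of a linear filter equation on the system matrix and
on the gain. -/
lemma norm_filter_sub_le {T a k d X : ℝ} {A₁ A₂ : Matrix (Fin n) (Fin n) ℝ}
    {C : Matrix (Fin r) (Fin n) ℝ} {K₁ K₂ : ℝ → Matrix (Fin n) (Fin r) ℝ}
    {x₀ : EuclideanSpace ℝ (Fin n)} {x₁ x₂ : ℝ → EuclideanSpace ℝ (Fin n)}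
    {y : ℝ → EuclideanSpace ℝ (Fin r)} (hy : IntervalIntegrable y volume 0 T)
    (hx₁ : ContinuousOn x₁ (Icc 0 T)) (hx₂ : ContinuousOn x₂ (Icc 0 T))
    (hK₁ : ContinuousOn K₁ (Icc 0 T)) (hK₂ : ContinuousOn K₂ (Icc 0 T))
    (heq₁ : ∀ t ∈ Icc 0 T, x₁ t = x₀ + ∫ s in (0 : ℝ)..t, (Matrix.toEuclideanLin A₁ (x₁ s)
      + Matrix.toEuclideanLin (K₁ s) (y s - Matrix.toEuclideanLin C (x₁ s))))
    (heq₂ : ∀ t ∈ Icc 0 T, x₂ t = x₀ + ∫ s in (0 : ℝ)..t, (Matrix.toEuclideanLin A₂ (x₂ s)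
      + Matrix.toEuclideanLin (K₂ s) (y s - Matrix.toEuclideanLin C (x₂ s))))
    (ha : ‖A₁‖ ≤ a) (hk0 : 0 ≤ k) (hk₁ : ∀ s ∈ Icc 0 T, ‖K₁ s‖ ≤ k)
    (hk₂ : ∀ s ∈ Icc 0 T, ‖K₂ s‖ ≤ k) (hd0 : 0 ≤ d) (hd : ∀ s ∈ Icc 0 T, ‖K₁ s - K₂ s‖ ≤ d)
    (hX0 : 0 ≤ X) (hX : ∀ s ∈ Icc 0 T, ‖x₂ s‖ ≤ X) :
    ∀ t ∈ Icc 0 T, ‖x₁ t - x₂ t‖ ≤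
      (T * (‖A₁ - A₂‖ * X + d * (‖C‖ * X)) + d * ∫ s in (0 : ℝ)..T, ‖y s‖)
        * Real.exp ((a + k * ‖C‖) * T) := by
  have ha0 : 0 ≤ a := (norm_nonneg _).trans ha
  have hhi : IntervalIntegrable (fun s => d * ‖y s‖) volume 0 T := hy.norm.const_mul d
  have := norm_le_of_integral_eq (L := a + k * ‖C‖) (f := fun t => x₁ t - x₂ t) (f₀ := 0)
    (g := fun s => (Matrix.toEuclideanLin A₁ (x₁ s)
      + Matrix.toEuclideanLin (K₁ s) (y s - Matrix.toEuclideanLin C (x₁ s)))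
      - (Matrix.toEuclideanLin A₂ (x₂ s)
      + Matrix.toEuclideanLin (K₂ s) (y s - Matrix.toEuclideanLin C (x₂ s))))
    (h := fun s => (‖A₁ - A₂‖ * X + d * (‖C‖ * X)) + d * ‖y s‖) (by positivity) (hx₁.sub hx₂)
    ?_ ((by simp : IntervalIntegrable (fun _ => _) volume 0 T).add hhi) (fun _ => by positivity) ?_
  · rw [intervalIntegral.integral_add (by simp) hhi, intervalIntegral.integral_const,
      intervalIntegral.integral_const_mul, norm_zero, zero_add, sub_zero, smul_eq_mul] at this
    exact this
  · intro t ht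
    rw [intervalIntegral.integral_sub (intervalIntegrable_filter hy hx₁ hK₁ hk₁ ht)
      (intervalIntegrable_filter hy hx₂ hK₂ hk₂ ht)]
    nth_rewrite 1 [heq₁ t ht, heq₂ t ht]
    abel
  · intro s hs
    have hs' := Ioo_subset_Icc_self hs
    -- The data differences act on `x₂` only, so the a priori bound `X` is needed for that
    -- trajectory alone.
    have hsplit : (Matrix.toEuclideanLin A₁ (x₁ s)
        + Matrix.toEuclideanLin (K₁ s) (y s - Matrix.toEuclideanLin C (x₁ s)))
        - (Matrix.toEuclideanLin A₂ (x₂ s)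
        + Matrix.toEuclideanLin (K₂ s) (y s - Matrix.toEuclideanLin C (x₂ s)))
        = (Matrix.toEuclideanLin A₁ (x₁ s - x₂ s)
          - Matrix.toEuclideanLin (K₁ s) (Matrix.toEuclideanLin C (x₁ s - x₂ s)))
        + (Matrix.toEuclideanLin (A₁ - A₂) (x₂ s)
          + Matrix.toEuclideanLin (K₁ s - K₂ s) (y s - Matrix.toEuclideanLin C (x₂ s))) := by
      simp only [map_sub, LinearMap.sub_apply]
      abel
    rw [hsplit]
    have e1 : ‖Matrix.toEuclideanLin A₁ (x₁ s - x₂ s)‖ ≤ a * ‖x₁ s - x₂ s‖ :=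
      (norm_toEuclideanLin_le _ _).trans (by gcongr)
    have e2 : ‖Matrix.toEuclideanLin (K₁ s) (Matrix.toEuclideanLin C (x₁ s - x₂ s))‖
        ≤ k * (‖C‖ * ‖x₁ s - x₂ s‖) :=
      (norm_toEuclideanLin_le _ _).trans
        (mul_le_mul (hk₁ s hs') (norm_toEuclideanLin_le _ _) (norm_nonneg _) hk0)
    have e3 : ‖Matrix.toEuclideanLin (A₁ - A₂) (x₂ s)‖ ≤ ‖A₁ - A₂‖ * X :=
      (norm_toEuclideanLin_le _ _).trans
        (mul_le_mul_of_nonneg_left (hX s hs') (norm_nonneg _))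
    have e4 : ‖y s - Matrix.toEuclideanLin C (x₂ s)‖ ≤ ‖y s‖ + ‖C‖ * X :=
      (norm_sub_le _ _).trans (add_le_add_right ((norm_toEuclideanLin_le _ _).trans
        (mul_le_mul_of_nonneg_left (hX s hs') (norm_nonneg _))) _)
    have e5 : ‖Matrix.toEuclideanLin (K₁ s - K₂ s) (y s - Matrix.toEuclideanLin C (x₂ s))‖
        ≤ d * (‖y s‖ + ‖C‖ * X) :=
      (norm_toEuclideanLin_le _ _).trans (mul_le_mul (hd s hs') e4 (norm_nonneg _) hd0)
    refine (norm_add_le _ _).trans ((add_le_add ((norm_sub_le _ _).trans (add_le_add e1 e2))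
      ((norm_add_le _ _).trans (add_le_add e3 e5))).trans (le_of_eq ?_))
    ring

/-- The Kalman filter depends on the data in a Lipschitz continuous way, uniformly over all
admissible data. -/
lemma exists_kalman_lipschitz (T : ℝ) (hT : 0 < T) (B : Matrix (Fin n) (Fin m) ℝ)
    (C : Matrix (Fin r) (Fin n) ℝ) (x₀ : EuclideanSpace ℝ (Fin n))
    (y : ℝ → EuclideanSpace ℝ (Fin r)) (hy : IntervalIntegrable y volume 0 T) {M : ℝ}
    (hM : 1 ≤ M) :
    ∃ c > 0, ∀ (S S' : Sys n m r), S.IsAdmissible M → S'.IsAdmissible M →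
      ∀ Pi Pi' x x', IsRiccatiSolution T B C S Pi → IsRiccatiSolution T B C S' Pi' →
        IsKalmanSolution T C x₀ y S Pi x → IsKalmanSolution T C x₀ y S' Pi' x' →
        ∀ t ∈ Icc 0 T, ‖x t - x' t‖ ≤ c * (S - S').norm1 := by
  obtain ⟨ε, hε, p, hp, hb⟩ := exists_riccati_bounds T B C hM
  obtain ⟨c₁, hc₁, hlip⟩ := exists_riccati_lipschitz T hT B C hM
  have hM0 : 0 < M := zero_lt_one.trans_le hM
  set Y := ∫ s in (0 : ℝ)..T, ‖y s‖ with hY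
  have hY0 : 0 ≤ Y := intervalIntegral.integral_nonneg hT.le fun s _ => norm_nonneg _
  -- Here `k` bounds the gains `Π Cᵀ Q⁻¹`, `X` bounds the trajectories, and `d` is the Lipschitz
  -- constant of the gain in the data.
  set k := p * ‖C‖ * M with hk
  have hk0 : 0 ≤ k := by positivity
  set E := Real.exp ((M + k * ‖C‖) * T) with hE
  have hE0 : 0 < E := Real.exp_pos _
  set X := (‖x₀‖ + k * Y) * E with hX
  have hX0 : 0 ≤ X := by positivity
  set d := c₁ * ‖C‖ * M + p * ‖C‖ * M ^ 2 with hd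
  have hd0 : 0 ≤ d := by positivity
  -- The summand `1` secures positivity: the rest vanishes when `x₀ = 0` and `Y = 0`.
  refine ⟨(T * (X + d * (‖C‖ * X)) + d * Y) * E + 1, by positivity, ?_⟩
  intro S S' hS hS' Pi Pi' x x' hPi hPi' hx hx' t ht
  have hgain : ∀ (S : Sys n m r), S.IsAdmissible M → ∀ Pi, IsRiccatiSolution T B C S Pi →
      ∀ s ∈ Icc 0 T, ‖Pi s * Cᵀ * S.Q⁻¹‖ ≤ k := by
    intro S hS Pi hPi s hs
    refine (norm_mul₃_le' _ _ _).trans ?_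
    rw [norm_transpose]
    have h1 := (hb S hS Pi hPi s hs).2
    have h2 := hS.norm_Q_inv
    rw [hk]
    gcongr
  have hN : (S - S').norm1 = ‖S.A - S'.A‖ + ‖S.Γ - S'.Γ‖ + ‖S.R - S'.R‖ + ‖S.Q - S'.Q‖ := rfl
  have nA := norm_nonneg (S.A - S'.A)
  have nΓ := norm_nonneg (S.Γ - S'.Γ)
  have nR := norm_nonneg (S.R - S'.R)
  have nQ := norm_nonneg (S.Q - S'.Q)
  have iA : ‖S.A - S'.A‖ ≤ (S - S').norm1 := by rw [hN]; linarith
  have iQ : ‖S.Q - S'.Q‖ ≤ (S - S').norm1 := by rw [hN]; linarith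
  have hN0 : 0 ≤ (S - S').norm1 := nA.trans iA
  have hdiff : ∀ s ∈ Icc 0 T,
      ‖Pi s * Cᵀ * S.Q⁻¹ - Pi' s * Cᵀ * S'.Q⁻¹‖ ≤ d * (S - S').norm1 := by
    intro s hs
    have hsplit : Pi s * Cᵀ * S.Q⁻¹ - Pi' s * Cᵀ * S'.Q⁻¹
        = (Pi s - Pi' s) * Cᵀ * S.Q⁻¹ + Pi' s * Cᵀ * (S.Q⁻¹ - S'.Q⁻¹) := by
      simp only [Matrix.sub_mul, Matrix.mul_sub]
      abel
    have h1 := hlip S S' hS hS' Pi Pi' hPi hPi' s hs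
    have h2 := norm_inv_sub_inv_le hS.Q_posDef hS'.Q_posDef hS.norm_Q_inv hS'.norm_Q_inv
    have h3 := (hb S' hS' Pi' hPi' s hs).2
    have h4 := hS.norm_Q_inv
    have e1 : ‖(Pi s - Pi' s) * Cᵀ * S.Q⁻¹‖ ≤ (c₁ * (S - S').norm1) * ‖C‖ * M := by
      refine (norm_mul₃_le' _ _ _).trans ?_
      rw [norm_transpose]
      gcongr
    have e2 : ‖Pi' s * Cᵀ * (S.Q⁻¹ - S'.Q⁻¹)‖ ≤ p * ‖C‖ * (M ^ 2 * (S - S').norm1) := by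
      refine (norm_mul₃_le' _ _ _).trans ?_
      rw [norm_transpose]
      have h5 := h2.trans (mul_le_mul_of_nonneg_left iQ (sq_nonneg M))
      gcongr
    rw [hsplit]
    refine (norm_add_le _ _).trans ((add_le_add e1 e2).trans (le_of_eq ?_))
    rw [hd]
    ring
  have hcont : ∀ (S : Sys n m r) Pi, IsRiccatiSolution T B C S Pi →
      ContinuousOn (fun s => Pi s * Cᵀ * S.Q⁻¹) (Icc 0 T) := by
    intro S Pi hPi
    exact (by fun_prop : Continuous fun Z : Matrix (Fin n) (Fin n) ℝ =>
      Z * Cᵀ * S.Q⁻¹).comp_continuousOn hPi.continuousOn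
  have hx'b := norm_filter_le hy hx'.continuousOn hx'.integral_eq hS'.norm_A hk0
    (hgain S' hS' Pi' hPi')
  have h := norm_filter_sub_le hy hx.continuousOn hx'.continuousOn (hcont S Pi hPi)
    (hcont S' Pi' hPi') hx.integral_eq hx'.integral_eq hS.norm_A hk0 (hgain S hS Pi hPi)
    (hgain S' hS' Pi' hPi') (mul_nonneg hd0 hN0) hdiff hX0 hx'b t ht
  refine h.trans ?_
  calc _ ≤ (T * ((S - S').norm1 * X + d * (S - S').norm1 * (‖C‖ * X))
        + d * (S - S').norm1 * Y) * E := by gcongr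
    _ = ((T * (X + d * (‖C‖ * X)) + d * Y) * E) * (S - S').norm1 := by ring
    _ ≤ _ := mul_le_mul_of_nonneg_right (by linarith) hN0

/-! ### Averaging over the parameters and conclusion -/

/-- `M` is arbitrary, whereas the uniform bounds assume `1 ≤ M`; hence the maximum. -/
lemma UncertainModel.isAdmissible {𝓜 : UncertainModel n m r} {M : ℝ} (h : 𝓜.BoundedBy M)
    {σ : 𝓜.Param} (hσ : σ ∈ 𝓜.paramSet) : (𝓜.sys σ).IsAdmissible (max M 1) := by
  obtain ⟨hA, hΓ, hR, -, hΓi, hQi⟩ := h σ hσ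
  simp only [UncertainModel.paramSet, Finset.mem_product] at hσ
  have hle := le_max_left M 1
  exact ⟨𝓜.γ_posDef _ hσ.2.1, 𝓜.ρ_posDef _ hσ.2.2.1, 𝓜.q_posDef _ hσ.2.2.2, hA.trans hle,
    hΓ.trans hle, hR.trans hle, hΓi.trans hle, hQi.trans hle⟩

/-- The distance of a mean to a point is at most the mean distance. -/
lemma UncertainModel.norm_expectation_sub_le {E : Type*} [NormedAddCommGroup E] [NormedSpace ℝ E]
    (𝓜 : UncertainModel n m r) (hne : 𝓜.paramSet.Nonempty) {f : 𝓜.Param → E} {z : E}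
    {g : 𝓜.Param → ℝ} {c : ℝ} (h : ∀ σ ∈ 𝓜.paramSet, ‖f σ - z‖ ≤ c * g σ) :
    ‖𝓜.expectation f - z‖ ≤ c * 𝓜.expectation g := by
  have hN : (𝓜.N : ℝ) ≠ 0 := by
    simpa [UncertainModel.N] using hne.ne_empty
  -- The weights sum to one, so `z` moves inside the mean.
  have heq : 𝓜.expectation f - z = (1 / (𝓜.N : ℝ)) • ∑ σ ∈ 𝓜.paramSet, (f σ - z) := by
    rw [Finset.sum_sub_distrib, Finset.sum_const, smul_sub, ← UncertainModel.N,
      ← Nat.cast_smul_eq_nsmul ℝ, smul_smul, one_div_mul_cancel hN, one_smul]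
    rfl
  rw [heq, norm_smul, Real.norm_of_nonneg (by positivity), UncertainModel.expectation, smul_eq_mul,
    mul_left_comm, Finset.mul_sum]
  exact mul_le_mul_of_nonneg_left (norm_sum_le_of_le _ h) (by positivity)

end UncertainKalman

theorem mainTheorem5 {n m r : ℕ} (T : ℝ) (hT : 0 < T)
    (B : Matrix (Fin n) (Fin m) ℝ) (C : Matrix (Fin r) (Fin n) ℝ)
    (x₀ : EuclideanSpace ℝ (Fin n)) (y : ℝ → EuclideanSpace ℝ (Fin r))
    (hy : MemLp y 2 (volume.restrict (Ioo 0 T))) (M : ℝ) :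
    ∃ c : ℝ, 0 < c ∧
      ∀ 𝓜 : UncertainKalman.UncertainModel n m r, 𝓜.BoundedBy M →
      ∀ (Pi : 𝓜.Param → ℝ → Matrix (Fin n) (Fin n) ℝ)
        (x : 𝓜.Param → ℝ → EuclideanSpace ℝ (Fin n)),
        (∀ σ ∈ 𝓜.paramSet, UncertainKalman.IsRiccatiSolution T B C (𝓜.sys σ) (Pi σ)) →
        (∀ σ ∈ 𝓜.paramSet,
          UncertainKalman.IsKalmanSolution T C x₀ y (𝓜.sys σ) (Pi σ) (x σ)) →
        ∀ σ' ∈ 𝓜.paramSet, ∀ t ∈ Icc 0 T,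
          UncertainKalman.weightedNorm (Pi σ' t)⁻¹ (𝓜.expectation (fun σ => x σ t) - x σ' t)
            ≤ c * 𝓜.expectation (fun σ => (𝓜.sys σ - 𝓜.sys σ').norm1) := by
  -- On a bounded interval `L²` embeds in `L¹`, and only the integral of `‖y‖` enters the constants.
  have hyi : IntervalIntegrable y volume 0 T := by
    rw [intervalIntegrable_iff_integrableOn_Ioo_of_le hT.le]
    exact hy.integrable one_le_two
  obtain ⟨ε, hε, p, -, hb⟩ := UncertainKalman.exists_riccati_bounds T B C (le_max_right M 1)
  obtain ⟨c, hc, hlip⟩ :=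
    UncertainKalman.exists_kalman_lipschitz T hT B C x₀ y hyi (le_max_right M 1)
  -- Both `ε` and `c` are fixed before the model is introduced, hence independent of it and of `N`.
  refine ⟨√ε⁻¹ * c, by positivity, ?_⟩
  intro 𝓜 h𝓜 Pi x hPi hx σ' hσ' t ht
  have hadm : ∀ σ ∈ 𝓜.paramSet, (𝓜.sys σ).IsAdmissible (max M 1) := fun σ hσ =>
    UncertainKalman.UncertainModel.isAdmissible h𝓜 hσ
  refine (UncertainKalman.weightedNorm_inv_le hε
    (hb _ (hadm σ' hσ') _ (hPi σ' hσ') t ht).1 _).trans ?_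
  rw [mul_assoc]
  refine mul_le_mul_of_nonneg_left (𝓜.norm_expectation_sub_le ⟨σ', hσ'⟩ fun σ hσ => ?_)
    (Real.sqrt_nonneg _)
  exact hlip _ _ (hadm σ hσ) (hadm σ' hσ') _ _ _ _ (hPi σ hσ) (hPi σ' hσ') (hx σ hσ)
    (hx σ' hσ') t ht
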